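/- For $n\in\mathbb N$ let $N=2^n$ and $M=2N$. For $f,g:\{0,1\}^n\to\{-1,1\}$ put $$\Phi_{f,g}=\frac1{2^{3n/2}}\sum_{x,y\in\{0,1\}^n}f(x)(-1)^{x\cdot y}g(y).$$ Pairs $\langle f,g\rangle$ are identified with strings in $\{-1,1\}^M$, and with strings in $\{0,1\}^M$ through $x\mapsto\frac{1+x}{2}$. Let $\mathcal U$ be the uniform distribution on such pairs. Let $\mathcal F$ be the distribution of $\langle f,g\rangle$ where $v=(v_x)_{x\in\{0,1\}^n}$ has independent standard Gaussian entries, $f(x)=\operatorname{sgn}(v_x)$ and $g(y)=\operatorname{sgn}(\widehat v_y)$ with $\widehat v_y=\frac1{\sqrt N}\sum_{x}(-1)^{x\cdot y}v_x$, and $\operatorname{sgn}(\alpha)=1$ if $\alpha\ge 0$, $\operatorname{sgn}(\alpha)=-1$ if $\alpha<0$. Let $\mathcal F'$ be $\mathcal F$ conditioned on $\Phi_{f,g}\ge 0.07$, and let $\mathcal U'$ be $\mathcal U$ conditioned on $|\Phi_{f,g}|\le 0.01$. A $k$-term $C$ is a product of $k$ literals $z_i$ or $1-z_i$ in $k$ different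 variables $z_i$ of a string $z\in\{0,1\}^M$. A distribution $\mathcal D$ on $\{0,1\}^M$ is $\varepsilon$-almost $k$-wise independent if $1-\varepsilon\le \Pr_{\mathcal D}[C=1]/\Pr_{\mathcal U}[C=1]\le 1+\varepsilon$ for every $k$-term $C$. **Lemma.** Let $k=k(n)$ be natural numbers with $k\le N^{o(1)}$, that is, $k(n)\le N^{\delta(n)}$ for all large $n$ and some real sequence $\delta(n)\to 0$. Then there is a real sequence $\varepsilon(n)\to0$ such that for all sufficiently large $n$ both conditioning events have positive probability (so that $\mathcal F'$ and $\mathcal U'$ are well defined) and $\mathcal F'$ and $\mathcal U'$ are $\varepsilon(n)$-almost $k(n)$-wise independent. -/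

import Mathlib

open scoped Topology

namespace Forrelation

noncomputable section

/-! Almost `k`-wise independence of distributions over `{0,1}^ι`, for a finite index set `ι`.
Bits are Booleans, with `true` for `1` and `false` for `0`. -/

/-- A `k`-term over the variables `z i`, `i : ι`: a product of `k` literals that involve the
`k` different variables in `vars`. The literal of the variable `z i` is `z i` if `val i = true` and
`1 - z i` if `val i = false` (the values of `val` outside `vars` play no role). -/
structure KTerm (ι : Type*) (k : ℕ) where
  vars : Finset ι
  card_vars : vars.card = k
  val : ι → Bool

/-- The event that the term takes the value `1`, that is, that all variables of the term take on
their prescribed values. -/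
def KTerm.event {ι : Type*} {k : ℕ} (C : KTerm ι k) : Set (ι → Bool) :=
  {z | ∀ i ∈ C.vars, z i = C.val i}

/-- The uniform distribution over `{0,1}^ι`. -/
def uniform (ι : Type*) : MeasureTheory.Measure (ι → Bool) :=
  ProbabilityTheory.uniformOn Set.univ

/-- `D` is `ε`-almost `k`-wise independent: `1 - ε ≤ Pr_D[C] / Pr_U[C] ≤ 1 + ε` for every `k`-term
`C`, with `U` the uniform distribution. -/
def AlmostKWiseIndependent {ι : Type*} (D : MeasureTheory.Measure (ι → Bool)) (ε : ℝ) (k : ℕ) :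
    Prop :=
  ∀ C : KTerm ι k,
    1 - ε ≤ D.real C.event / (uniform ι).real C.event ∧
      D.real C.event / (uniform ι).real C.event ≤ 1 + ε

/-! The forrelation quantity and the input distributions. -/

/-- The cube `{0,1}^n`. -/
abbrev Cube (n : ℕ) : Type := Fin n → Bool

/-- The inner product `x · y` (its parity is all that matters). -/
def dot {n : ℕ} (x y : Cube n) : ℕ := ∑ i, (x i).toNat * (y i).toNat

/-- The index set of the input strings; it has `M = 2 * 2^n` elements. -/
abbrev Index (n : ℕ) : Type := Cube n ⊕ Cube n

/-- The element of `{-1,1}` that is encoded by a bit: the inverse of `x ↦ (1 + x) / 2`. -/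
def spin (b : Bool) : ℝ := if b then 1 else -1

/-- `Φ_{f,g} = 2^{-3n/2} ∑_{x,y} f(x) (-1)^{x·y} g(y)`. -/
def phi {n : ℕ} (f g : Cube n → ℝ) : ℝ :=
  1 / (2 : ℝ) ^ (3 * (n : ℝ) / 2) * ∑ x, ∑ y, f x * (-1) ^ dot x y * g y

/-- `Φ_{f,g}` for the pair of functions `f, g : {0,1}^n → {-1,1}` encoded by the bit string `z`,
with `f` in the first half of `z` and `g` in the second half. -/
def phiString {n : ℕ} (z : Index n → Bool) : ℝ :=
  phi (fun x => spin (z (Sum.inl x))) (fun y => spin (z (Sum.inr y)))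

/-- The Fourier transform over `ℤ₂^n`: `v̂_y = N^{-1/2} ∑_x (-1)^{x·y} v_x` with `N = 2^n`. -/
def fourierTransform {n : ℕ} (v : Cube n → ℝ) (y : Cube n) : ℝ :=
  1 / √((2 : ℝ) ^ n) * ∑ x, (-1) ^ dot x y * v x

/-- The bit that encodes `sgn a`, where `sgn a = 1` if `a ≥ 0` and `sgn a = -1` if `a < 0`. -/
def sgnBit (a : ℝ) : Bool := decide (0 ≤ a)

theorem spin_sgnBit (a : ℝ) : spin (sgnBit a) = if 0 ≤ a then 1 else -1 := by
  simp [spin, sgnBit]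

/-- The string of the pair `f = sgn v`, `g = sgn v̂`. -/
def forrelatedString {n : ℕ} (v : Cube n → ℝ) : Index n → Bool :=
  Sum.elim (fun x => sgnBit (v x)) (fun y => sgnBit (fourierTransform v y))

theorem measurable_sgnBit : Measurable sgnBit :=
  measurable_to_bool (by
    have h : sgnBit ⁻¹' {true} = Set.Ici 0 := by ext; simp [sgnBit]
    rw [h]; exact measurableSet_Ici)

theorem measurable_forrelatedString (n : ℕ) : Measurable (forrelatedString (n := n)) := by
  refine measurable_pi_lambda _ ?_
  rintro (x | y)
  · exact measurable_sgnBit.comp (measurable_pi_apply x)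
  · refine measurable_sgnBit.comp (g := sgnBit) (f := fun v => fourierTransform v y) ?_
    unfold fourierTransform
    fun_prop

/-- The forrelated distribution `𝓕`: the law of the pair `(sgn v, sgn v̂)` when the entries of `v`
are independent standard Gaussians. -/
def forrelated (n : ℕ) : MeasureTheory.Measure (Index n → Bool) :=
  (MeasureTheory.Measure.pi fun _ : Cube n => ProbabilityTheory.gaussianReal 0 1).map
    forrelatedString

/-- `𝓕'`: the forrelated distribution conditioned on `Φ ≥ 0.07`. -/
def forrelatedCond (n : ℕ) : MeasureTheory.Measure (Index n → Bool) :=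
  ProbabilityTheory.cond (forrelated n) {z | 0.07 ≤ phiString z}

/-- `𝓤'`: the uniform distribution conditioned on `|Φ| ≤ 0.01`. -/
def uniformCond (n : ℕ) : MeasureTheory.Measure (Index n → Bool) :=
  ProbabilityTheory.cond (uniform (Index n)) {z | |phiString z| ≤ 0.01}

end

end Forrelation

/-!
Any `k` entries of `(v, v̂)` are the inner products of `v` with unit vectors whose pairwise inner
products are at most `1 / √N`, so their joint law is Gaussian with covariance close to the
identity. Orthants are cones, and a linear map which nearly preserves norms changes the Gaussian
measure of a cone only by a factor near `1`: rescaled to a contraction or an expansion it compares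
densities pointwise, and its determinant is read off from the whole space, which is a cone as well.
Hence `k`-terms have almost their uniform probability under `𝓕`, with error `O(k² / √N)`.

For the conditioning, `f = sgn v` and `g = sgn v̂` are each at squared distance about `(1 - 2/π) N`
from the multiples `√(2/π) v` and `√(2/π) v̂`, which the Fourier isometry exchanges; the triangle
inequality gives `Φ ≥ 4/π - 1 - o(1) > 0.07`, up to an exponentially small probability by Cramér's
bound. Under `𝓤` the variable `Φ` is sub-Gaussian with variance `1 / N`. So both events fail with
probability `exp (-c N)`, which is negligible against the probability `2 ^ (-k)` of a `k`-term.
-/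

namespace Forrelation

open Asymptotics MeasureTheory ProbabilityTheory Matrix
open scoped RealInnerProductSpace MatrixOrder

section GaussianDensity

variable {E : Type*} [NormedAddCommGroup E] [InnerProductSpace ℝ E]

/-- The density of the standard Gaussian measure of a finite-dimensional inner product space with
respect to the volume; see `stdGaussian_eq_withDensity`. -/
noncomputable def gaussianDensity (x : E) : ℝ :=
  ((2 * Real.pi) ^ (Module.finrank ℝ E / 2 : ℝ))⁻¹ * Real.exp (-‖x‖ ^ 2 / 2)

lemma gaussianDensity_nonneg (x : E) : 0 ≤ gaussianDensity x := by
  unfold gaussianDensity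
  positivity

lemma gaussianDensity_le_gaussianDensity {x y : E} (h : ‖y‖ ≤ ‖x‖) :
    gaussianDensity x ≤ gaussianDensity y := by
  unfold gaussianDensity
  gcongr

variable [MeasurableSpace E] [BorelSpace E]

lemma measurable_gaussianDensity : Measurable (gaussianDensity (E := E)) := by
  unfold gaussianDensity
  fun_prop

variable [FiniteDimensional ℝ E]

lemma integrable_gaussianDensity : Integrable (gaussianDensity (E := E)) := by
  have h := (GaussianFourier.integrable_cexp_neg_mul_sq_norm_add (V := E) (b := 1 / 2)
    (by norm_num) 0 0).norm
  refine (h.congr (.of_forall fun x => ?_)).const_mul _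
  norm_num [Complex.norm_exp, ← Complex.ofReal_pow]
  ring_nf

lemma charFun_withDensity_gaussianDensity (t : E) :
    charFun (volume.withDensity fun x : E => ENNReal.ofReal (gaussianDensity x)) t =
      Complex.exp (-‖t‖ ^ 2 / 2) := by
  have hfourier := GaussianFourier.integral_cexp_neg_mul_sq_norm_add (V := E) (b := 1 / 2)
    (by norm_num) Complex.I t
  set Z : ℝ := (2 * Real.pi) ^ (Module.finrank ℝ E / 2 : ℝ) with hZ
  have hZ0 : (Z : ℂ) ≠ 0 := Complex.ofReal_ne_zero.2 (by positivity)
  have hZc : (Real.pi / (1 / 2) : ℂ) ^ (Module.finrank ℝ E / 2 : ℂ) = Z := by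
    rw [hZ, Complex.ofReal_cpow (by positivity)]
    push_cast
    ring_nf
  have hintegrand (x : E) :
      (ENNReal.ofReal (gaussianDensity x)).toReal • Complex.exp (⟪x, t⟫ * Complex.I) =
        (Z : ℂ)⁻¹ * Complex.exp (-(1 / 2) * ‖x‖ ^ 2 + Complex.I * ⟪t, x⟫) := by
    rw [ENNReal.toReal_ofReal (gaussianDensity_nonneg x), gaussianDensity, ← hZ, Complex.real_smul,
      Complex.exp_add, real_inner_comm]
    push_cast
    ring_nf
  rw [charFun_apply, integral_withDensity_eq_integral_toReal_smul
    measurable_gaussianDensity.ennreal_ofReal (.of_forall fun x => ENNReal.ofReal_lt_top)]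
  simp only [hintegrand]
  rw [integral_const_mul, hfourier, hZc, inv_mul_cancel_left₀ hZ0, Complex.I_sq]
  ring_nf

theorem stdGaussian_eq_withDensity :
    stdGaussian E = volume.withDensity fun x => ENNReal.ofReal (gaussianDensity x) := by
  have := isFiniteMeasure_withDensity_ofReal (integrable_gaussianDensity (E := E)).2
  refine Measure.ext_of_charFun (funext fun t => ?_)
  rw [charFun_stdGaussian, charFun_withDensity_gaussianDensity]

lemma stdGaussian_apply_eq_lintegral_comp {B : E →ₗ[ℝ] E} (hB : LinearMap.det B ≠ 0) {s : Set E}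
    (hs : MeasurableSet s) :
    stdGaussian E s = ENNReal.ofReal |LinearMap.det B| *
      ∫⁻ u in B ⁻¹' s, ENNReal.ofReal (gaussianDensity (B u)) := by
  have hBm : Measurable B := B.continuous_of_finiteDimensional.measurable
  have hvol : (volume : Measure E) = ENNReal.ofReal |LinearMap.det B| • volume.map B := by
    rw [Measure.map_linearMap_addHaar_eq_smul_addHaar _ hB, smul_smul,
      ← ENNReal.ofReal_mul (abs_nonneg _), ← abs_mul, mul_inv_cancel₀ hB, abs_one,
      ENNReal.ofReal_one, one_smul]
  rw [stdGaussian_eq_withDensity, withDensity_apply _ hs,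
    ← setLIntegral_map hs measurable_gaussianDensity.ennreal_ofReal hBm]
  conv_lhs => rw [hvol]
  rw [Measure.restrict_smul, lintegral_smul_measure, smul_eq_mul]

lemma abs_det_mul_stdGaussian_preimage_le {B : E →ₗ[ℝ] E} (hB : ∀ u, ‖B u‖ ≤ ‖u‖) {s : Set E}
    (hs : MeasurableSet s) :
    |LinearMap.det B| * (stdGaussian E).real (B ⁻¹' s) ≤ (stdGaussian E).real s := by
  rcases eq_or_ne (LinearMap.det B) 0 with hdet | hdet
  · simp [hdet]
  have hBm : Measurable B := B.continuous_of_finiteDimensional.measurable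
  have h : ENNReal.ofReal |LinearMap.det B| * stdGaussian E (B ⁻¹' s) ≤ stdGaussian E s := by
    rw [stdGaussian_apply_eq_lintegral_comp hdet hs, stdGaussian_eq_withDensity,
      withDensity_apply _ (hBm hs)]
    gcongr with u
    exact gaussianDensity_le_gaussianDensity (hB u)
  simpa [measureReal_def] using ENNReal.toReal_mono (measure_ne_top _ s) h

lemma stdGaussian_le_abs_det_mul_preimage {B : E →ₗ[ℝ] E} (hB : ∀ u, ‖u‖ ≤ ‖B u‖) {s : Set E}
    (hs : MeasurableSet s) :
    (stdGaussian E).real s ≤ |LinearMap.det B| * (stdGaussian E).real (B ⁻¹' s) := by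
  have hdet : LinearMap.det B ≠ 0 := by
    refine (LinearMap.isUnit_det B (LinearMap.isUnit_iff_ker_eq_bot B |>.2 ?_)).ne_zero
    exact LinearMap.ker_eq_bot'.2 fun u hu => norm_le_zero_iff.1 (by simpa [hu] using hB u)
  have hBm : Measurable B := B.continuous_of_finiteDimensional.measurable
  have h : stdGaussian E s ≤ ENNReal.ofReal |LinearMap.det B| * stdGaussian E (B ⁻¹' s) := by
    rw [stdGaussian_apply_eq_lintegral_comp hdet hs, stdGaussian_eq_withDensity,
      withDensity_apply _ (hBm hs)]
    gcongr with u
    exact gaussianDensity_le_gaussianDensity (hB u)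
  simpa [measureReal_def] using ENNReal.toReal_mono (by finiteness) h

lemma abs_det_mul_stdGaussian_preimage_le_of_cone {A : E →ₗ[ℝ] E} {c : ℝ} (hc : 0 < c)
    (hA : ∀ u, ‖A u‖ ≤ c * ‖u‖) {s : Set E} (hs : MeasurableSet s)
    (hcone : ∀ a : ℝ, 0 < a → (a • ·) ⁻¹' s = s) :
    |LinearMap.det A| * (stdGaussian E).real (A ⁻¹' s) ≤
      c ^ Module.finrank ℝ E * (stdGaussian E).real s := by
  have h := abs_det_mul_stdGaussian_preimage_le (B := c⁻¹ • A) (fun u => by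
    rw [LinearMap.smul_apply, norm_smul, Real.norm_of_nonneg (by positivity)]
    exact (inv_mul_le_iff₀ hc).2 (hA u)) hs
  have hpre : (c⁻¹ • A) ⁻¹' s = A ⁻¹' s := congrArg (A ⁻¹' ·) (hcone c⁻¹ (inv_pos.2 hc))
  rw [hpre, LinearMap.det_smul, abs_mul, abs_pow, abs_of_pos (inv_pos.2 hc), inv_pow,
    mul_assoc] at h
  exact (inv_mul_le_iff₀ (by positivity)).1 h

lemma pow_mul_stdGaussian_le_of_cone {A : E →ₗ[ℝ] E} {c : ℝ} (hc : 0 < c)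
    (hA : ∀ u, c * ‖u‖ ≤ ‖A u‖) {s : Set E} (hs : MeasurableSet s)
    (hcone : ∀ a : ℝ, 0 < a → (a • ·) ⁻¹' s = s) :
    c ^ Module.finrank ℝ E * (stdGaussian E).real s ≤
      |LinearMap.det A| * (stdGaussian E).real (A ⁻¹' s) := by
  have h := stdGaussian_le_abs_det_mul_preimage (B := c⁻¹ • A) (fun u => by
    rw [LinearMap.smul_apply, norm_smul, Real.norm_of_nonneg (by positivity)]
    exact (le_inv_mul_iff₀ hc).2 (hA u)) hs
  have hpre : (c⁻¹ • A) ⁻¹' s = A ⁻¹' s := congrArg (A ⁻¹' ·) (hcone c⁻¹ (inv_pos.2 hc))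
  rw [hpre, LinearMap.det_smul, abs_mul, abs_pow, abs_of_pos (inv_pos.2 hc), inv_pow,
    mul_assoc] at h
  exact (le_inv_mul_iff₀ (by positivity)).1 h

lemma one_sub_mul_sqrt_one_add_le {e : ℝ} (he0 : 0 ≤ e) (he1 : e ≤ 1) :
    (1 - e) * √(1 + e) ≤ √(1 - e) := by
  refine Real.le_sqrt_of_sq_le ?_
  rw [mul_pow, Real.sq_sqrt (by linarith)]
  nlinarith [mul_nonneg (sub_nonneg.2 he1) (sq_nonneg e)]

-- The whole space is a cone too, which pins down `|det A|`: no determinant has to be computed.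
theorem one_sub_pow_mul_stdGaussian_le_of_cone {A : E →ₗ[ℝ] E} {e : ℝ} (he0 : 0 ≤ e)
    (he1 : e < 1) (hA : ∀ u, |‖A u‖ ^ 2 - ‖u‖ ^ 2| ≤ e * ‖u‖ ^ 2) {s : Set E} (hs : MeasurableSet s)
    (hcone : ∀ a : ℝ, 0 < a → (a • ·) ⁻¹' s = s) :
    (1 - e) ^ Module.finrank ℝ E * (stdGaussian E).real s ≤ (stdGaussian E).real (A ⁻¹' s) ∧
    (1 - e) ^ Module.finrank ℝ E * (stdGaussian E).real (A ⁻¹' s) ≤ (stdGaussian E).real s := by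
  have hplus : 0 < √(1 + e) := Real.sqrt_pos.2 (by linarith)
  have hminus : 0 < √(1 - e) := Real.sqrt_pos.2 (by linarith)
  have hle (u : E) : ‖A u‖ ≤ √(1 + e) * ‖u‖ := by
    refine abs_le_of_sq_le_sq' ?_ (by positivity) |>.2
    rw [mul_pow, Real.sq_sqrt (by linarith)]
    linarith [abs_le.1 (hA u)]
  have hge (u : E) : √(1 - e) * ‖u‖ ≤ ‖A u‖ := by
    refine abs_le_of_sq_le_sq' ?_ (norm_nonneg _) |>.2
    rw [mul_pow, Real.sq_sqrt (by linarith)]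
    linarith [abs_le.1 (hA u)]
  have hratio : (1 - e) ^ Module.finrank ℝ E * √(1 + e) ^ Module.finrank ℝ E ≤
      √(1 - e) ^ Module.finrank ℝ E := by
    rw [← mul_pow]
    exact pow_le_pow_left₀ (mul_nonneg (by linarith) hplus.le)
      (one_sub_mul_sqrt_one_add_le he0 he1.le) _
  have hdet_le : |LinearMap.det A| ≤ √(1 + e) ^ Module.finrank ℝ E := by
    simpa using abs_det_mul_stdGaussian_preimage_le_of_cone hplus hle .univ fun _ _ => rfl
  have hdet_ge : √(1 - e) ^ Module.finrank ℝ E ≤ |LinearMap.det A| := by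
    simpa using pow_mul_stdGaussian_le_of_cone hminus hge .univ fun _ _ => rfl
  have hpre_le := abs_det_mul_stdGaussian_preimage_le_of_cone hplus hle hs hcone
  have hpre_ge := pow_mul_stdGaussian_le_of_cone hminus hge hs hcone
  set p := (stdGaussian E).real (A ⁻¹' s)
  set q := (stdGaussian E).real s
  set d := Module.finrank ℝ E
  have hpos : 0 < √(1 + e) ^ Module.finrank ℝ E := by positivity
  constructor <;> refine le_of_mul_le_mul_left ?_ hpos
  · calc √(1 + e) ^ d * ((1 - e) ^ d * q) = (1 - e) ^ d * √(1 + e) ^ d * q := by ring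
      _ ≤ √(1 - e) ^ d * q := by gcongr
      _ ≤ |LinearMap.det A| * p := hpre_ge
      _ ≤ √(1 + e) ^ d * p := by gcongr
  · calc √(1 + e) ^ d * ((1 - e) ^ d * p) = (1 - e) ^ d * √(1 + e) ^ d * p := by ring
      _ ≤ √(1 - e) ^ d * p := by gcongr
      _ ≤ |LinearMap.det A| * p := by gcongr
      _ ≤ √(1 + e) ^ d * q := hpre_le

end GaussianDensity

section GaussianSigns

variable {κ : Type*}

/-- The orthant of the vectors whose sign pattern is `s`. -/
def orthant (s : κ → Bool) : Set (EuclideanSpace ℝ κ) := {w | ∀ i, sgnBit (w i) = s i}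

lemma measurableSet_orthant [Finite κ] (s : κ → Bool) : MeasurableSet (orthant s) := by
  have : orthant s = ⋂ i, (fun w : EuclideanSpace ℝ κ => sgnBit (w i)) ⁻¹' {s i} := by
    ext; simp [orthant]
  rw [this]
  exact .iInter fun i => (measurable_sgnBit.comp (by fun_prop)) (measurableSet_singleton _)

lemma sgnBit_mul_of_pos {a : ℝ} (ha : 0 < a) (x : ℝ) : sgnBit (a * x) = sgnBit x := by
  simp [sgnBit, mul_nonneg_iff_of_pos_left ha]

lemma smul_preimage_orthant (s : κ → Bool) {a : ℝ} (ha : 0 < a) :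
    (a • ·) ⁻¹' orthant s = orthant s := by
  ext w
  simp [orthant, sgnBit_mul_of_pos ha]

lemma gaussianReal_sgnBit_preimage (b : Bool) :
    (gaussianReal 0 1).real (sgnBit ⁻¹' {b}) = 1 / 2 := by
  have := nullSingletonClass_gaussianReal (μ := 0) one_ne_zero
  have hsymm : (gaussianReal 0 1).real (Set.Iio 0) = (gaussianReal 0 1).real (Set.Ici 0) := by
    have hneg : (gaussianReal 0 1).map (fun x => -x) = gaussianReal 0 1 := by
      rw [gaussianReal_map_neg, neg_zero]
    rw [measureReal_congr Iio_ae_eq_Iic]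
    conv_rhs => rw [← hneg, map_measureReal_apply measurable_neg measurableSet_Ici]
    simp
  have htotal := measureReal_add_measureReal_compl (μ := gaussianReal 0 1)
    (measurableSet_Ici (a := (0 : ℝ)))
  rw [Set.compl_Ici, probReal_univ] at htotal
  have htrue : sgnBit ⁻¹' {true} = Set.Ici 0 := by ext; simp [sgnBit]
  have hfalse : sgnBit ⁻¹' {false} = Set.Iio 0 := by ext; simp [sgnBit]
  cases b
  · rw [hfalse]; linarith
  · rw [htrue]; linarith

variable [Fintype κ]

lemma stdGaussian_real_orthant (s : κ → Bool) :
    (stdGaussian (EuclideanSpace ℝ κ)).real (orthant s) = (1 / 2) ^ Fintype.card κ := by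
  have hpre : WithLp.toLp 2 ⁻¹' orthant s = Set.univ.pi fun i => sgnBit ⁻¹' {s i} := by
    ext; simp [orthant]
  rw [← map_pi_eq_stdGaussian, map_measureReal_apply (by fun_prop) (measurableSet_orthant s), hpre,
    measureReal_def, Measure.pi_pi, ENNReal.toReal_prod]
  simp [← measureReal_def, gaussianReal_sgnBit_preimage]

lemma dotProduct_self_eq_norm_sq (u : EuclideanSpace ℝ κ) : u ⬝ᵥ u = ‖u‖ ^ 2 := by
  simp only [EuclideanSpace.real_norm_sq_eq, dotProduct, ← sq]

lemma norm_sq_toEuclideanCLM_sqrt [DecidableEq κ] {S : Matrix κ κ ℝ} (hS : S.PosSemidef)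
    (u : EuclideanSpace ℝ κ) :
    ‖toEuclideanCLM (𝕜 := ℝ) (CFC.sqrt S) u‖ ^ 2 = u ⬝ᵥ S *ᵥ u := by
  have hsymm : (CFC.sqrt S)ᵀ = CFC.sqrt S :=
    (nonneg_iff_posSemidef.1 (CFC.sqrt_nonneg S)).isHermitian
  rw [← dotProduct_self_eq_norm_sq, ofLp_toEuclideanCLM, dotProduct_mulVec, ← mulVec_transpose,
    hsymm, mulVec_mulVec, CFC.sqrt_mul_sqrt_self S hS.nonneg, dotProduct_comm]

lemma abs_dotProduct_mulVec_le {M : Matrix κ κ ℝ} {δ : ℝ} (hM : ∀ i j, |M i j| ≤ δ) (u : κ → ℝ) :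
    |u ⬝ᵥ M *ᵥ u| ≤ Fintype.card κ * δ * (u ⬝ᵥ u) := by
  rcases isEmpty_or_nonempty κ with h | ⟨⟨i⟩⟩
  · simp [dotProduct]
  have hδ : 0 ≤ δ := (abs_nonneg _).trans (hM i i)
  calc |u ⬝ᵥ M *ᵥ u| = |∑ i, ∑ j, u i * (M i j * u j)| := by
        simp only [dotProduct, mulVec, Finset.mul_sum]
    _ ≤ ∑ i, ∑ j, |u i| * (δ * |u j|) := by
        refine (Finset.abs_sum_le_sum_abs _ _).trans (Finset.sum_le_sum fun i _ => ?_)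
        refine (Finset.abs_sum_le_sum_abs _ _).trans (Finset.sum_le_sum fun j _ => ?_)
        rw [abs_mul, abs_mul]
        gcongr
        exact hM i j
    _ = δ * (∑ i, |u i|) ^ 2 := by
        rw [sq, Finset.sum_mul_sum, Finset.mul_sum]
        simp only [Finset.mul_sum, mul_left_comm]
    _ ≤ δ * (Fintype.card κ * ∑ i, |u i| ^ 2) := by
        gcongr
        exact sq_sum_le_card_mul_sum_sq
    _ = Fintype.card κ * δ * (u ⬝ᵥ u) := by
        simp only [dotProduct, sq_abs, ← sq]
        ring

lemma abs_sub_le_of_one_sub_pow_mul_le {d : ℕ} {e p q : ℝ} (hq : 0 ≤ q) (he0 : 0 ≤ e)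
    (he1 : e ≤ 1) (hde : d * e ≤ 1 / 2) (hpq : (1 - e) ^ d * q ≤ p) (hqp : (1 - e) ^ d * p ≤ q) :
    |p - q| ≤ 2 * (d * e) * q := by
  have hbernoulli : 1 - d * e ≤ (1 - e) ^ d := by
    simpa [sub_eq_add_neg] using one_add_mul_le_pow (a := -e) (by linarith) d
  have hp : 0 ≤ p := hpq.trans' (mul_nonneg (pow_nonneg (by linarith) d) hq)
  have hlower : (1 - d * e) * q ≤ p := hpq.trans' (by gcongr)
  have hupper : (1 - d * e) * p ≤ q := hqp.trans' (by gcongr)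
  have hp_le : p ≤ 2 * q := by nlinarith only [hupper, hde, hp]
  rw [abs_sub_le_iff]
  have hde0 : 0 ≤ d * e := by positivity
  constructor <;> nlinarith [mul_le_mul_of_nonneg_left hp_le hde0]

theorem abs_multivariateGaussian_sub_stdGaussian_le_of_cone [DecidableEq κ] {S : Matrix κ κ ℝ}
    (hS : S.PosSemidef) {e : ℝ} (he0 : 0 ≤ e) (he1 : e < 1) (hcard : Fintype.card κ * e ≤ 1 / 2)
    (hSe : ∀ u : κ → ℝ, |u ⬝ᵥ (S - 1) *ᵥ u| ≤ e * (u ⬝ᵥ u)) {s : Set (EuclideanSpace ℝ κ)}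
    (hs : MeasurableSet s) (hcone : ∀ a : ℝ, 0 < a → (a • ·) ⁻¹' s = s) :
    |(multivariateGaussian 0 S).real s - (stdGaussian (EuclideanSpace ℝ κ)).real s| ≤
      2 * (Fintype.card κ * e) * (stdGaussian (EuclideanSpace ℝ κ)).real s := by
  have hA (u : EuclideanSpace ℝ κ) :
      |‖toEuclideanCLM (𝕜 := ℝ) (CFC.sqrt S) u‖ ^ 2 - ‖u‖ ^ 2| ≤ e * ‖u‖ ^ 2 := by
    have h := hSe u
    rwa [sub_mulVec, one_mulVec, dotProduct_sub, ← norm_sq_toEuclideanCLM_sqrt hS,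
      dotProduct_self_eq_norm_sq] at h
  obtain ⟨hlower, hupper⟩ := one_sub_pow_mul_stdGaussian_le_of_cone
    (A := (toEuclideanCLM (𝕜 := ℝ) (CFC.sqrt S)).toLinearMap) he0 he1 hA hs hcone
  have hmap : (multivariateGaussian 0 S).real s =
      (stdGaussian _).real (toEuclideanCLM (𝕜 := ℝ) (CFC.sqrt S) ⁻¹' s) := by
    simp only [multivariateGaussian, zero_add]
    exact map_measureReal_apply (by fun_prop) hs
  rw [hmap]
  rw [finrank_euclideanSpace] at hlower hupper
  exact abs_sub_le_of_one_sub_pow_mul_le measureReal_nonneg he0 he1.le hcard hlower hupper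

theorem abs_two_pow_mul_multivariateGaussian_orthant_sub_one_le [DecidableEq κ]
    {S : Matrix κ κ ℝ} (hS : S.PosSemidef) {δ : ℝ} (hδ : 0 ≤ δ) (hSδ : ∀ i j, |(S - 1) i j| ≤ δ)
    (hcard : Fintype.card κ ^ 2 * δ ≤ 1 / 2) (s : κ → Bool) :
    |2 ^ Fintype.card κ * (multivariateGaussian 0 S).real (orthant s) - 1| ≤
      2 * (Fintype.card κ ^ 2 * δ) := by
  have hlt : Fintype.card κ * δ < 1 := by
    have : (Fintype.card κ : ℝ) ≤ Fintype.card κ ^ 2 := mod_cast Nat.le_self_pow two_ne_zero _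
    nlinarith
  have h := abs_multivariateGaussian_sub_stdGaussian_le_of_cone hS (by positivity) hlt
    (by linarith) (abs_dotProduct_mulVec_le hSδ) (measurableSet_orthant s)
    fun a ha => smul_preimage_orthant s ha
  rw [stdGaussian_real_orthant] at h
  have hpow : (2 : ℝ) ^ Fintype.card κ * (1 / 2) ^ Fintype.card κ = 1 := by
    rw [← mul_pow]; norm_num
  calc |2 ^ Fintype.card κ * (multivariateGaussian 0 S).real (orthant s) - 1|
      = 2 ^ Fintype.card κ *
          |(multivariateGaussian 0 S).real (orthant s) - (1 / 2) ^ Fintype.card κ| := by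
        rw [← abs_of_pos (show (0 : ℝ) < 2 ^ Fintype.card κ by positivity), ← abs_mul, mul_sub,
          abs_of_pos (show (0 : ℝ) < 2 ^ Fintype.card κ by positivity), hpow]
    _ ≤ 2 ^ Fintype.card κ * (2 * (Fintype.card κ * (Fintype.card κ * δ)) *
          (1 / 2) ^ Fintype.card κ) := by gcongr
    _ = 2 * (Fintype.card κ ^ 2 * δ) * (2 ^ Fintype.card κ * (1 / 2) ^ Fintype.card κ) := by ring
    _ = 2 * (Fintype.card κ ^ 2 * δ) := by rw [hpow, mul_one]

lemma map_inner_stdGaussian {E : Type*} [NormedAddCommGroup E] [InnerProductSpace ℝ E]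
    [FiniteDimensional ℝ E] [MeasurableSpace E] [BorelSpace E] [DecidableEq κ] (r : κ → E) :
    (stdGaussian E).map (fun v => WithLp.toLp 2 fun i => ⟪r i, v⟫) =
      multivariateGaussian 0 (gram ℝ r) := by
  refine Measure.ext_of_charFun (funext fun t => ?_)
  have hinner (v : E) : ⟪WithLp.toLp 2 fun i => ⟪r i, v⟫, t⟫ = ⟪v, ∑ i, t i • r i⟫ := by
    simp [PiLp.inner_apply, inner_sum, real_inner_smul_right, real_inner_comm, mul_comm]
  rw [charFun_apply, integral_map (by fun_prop) (by fun_prop)]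
  simp only [hinner]
  rw [← charFun_apply, charFun_stdGaussian, charFun_multivariateGaussian (posSemidef_gram ℝ r)]
  have hquad := star_dotProduct_gram_mulVec (𝕜 := ℝ) r t t
  rw [star_trivial, real_inner_self_eq_norm_sq] at hquad
  rw [hquad, inner_zero_right, Complex.ofReal_zero, zero_mul, zero_sub, Complex.ofReal_pow,
    neg_div]

theorem abs_two_pow_mul_stdGaussian_sgnBit_inner_sub_one_le {E : Type*} [NormedAddCommGroup E]
    [InnerProductSpace ℝ E] [FiniteDimensional ℝ E] [MeasurableSpace E] [BorelSpace E]
    {r : κ → E} (hr : ∀ i, ‖r i‖ = 1) {δ : ℝ} (hδ : 0 ≤ δ)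
    (hrδ : ∀ i j, i ≠ j → |⟪r i, r j⟫| ≤ δ) (hcard : Fintype.card κ ^ 2 * δ ≤ 1 / 2)
    (s : κ → Bool) :
    |2 ^ Fintype.card κ * (stdGaussian E).real {v | ∀ i, sgnBit ⟪r i, v⟫ = s i} - 1| ≤
      2 * (Fintype.card κ ^ 2 * δ) := by
  classical
  have hgram (i j : κ) : |(gram ℝ r - 1) i j| ≤ δ := by
    rcases eq_or_ne i j with rfl | hij
    · simpa [real_inner_self_eq_norm_sq, hr] using hδ
    · simpa [one_apply_ne hij] using hrδ i j hij
  have h := abs_two_pow_mul_multivariateGaussian_orthant_sub_one_le (posSemidef_gram ℝ r) hδ hgram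
    hcard s
  rwa [← map_inner_stdGaussian,
    map_measureReal_apply (by fun_prop) (measurableSet_orthant s)] at h

end GaussianSigns

section WalshBasis

variable {n : ℕ}

lemma sum_neg_one_pow_dot_mul (y z : Cube n) :
    ∑ x : Cube n, ((-1 : ℝ) ^ dot x y * (-1) ^ dot x z) = if y = z then 2 ^ n else 0 := by
  calc ∑ x : Cube n, ((-1 : ℝ) ^ dot x y * (-1) ^ dot x z)
      = ∑ x : Cube n, ∏ i,
          ((-1 : ℝ) ^ ((x i).toNat * (y i).toNat) * (-1) ^ ((x i).toNat * (z i).toNat)) := by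
        simp only [dot, ← Finset.prod_pow_eq_pow_sum, Finset.prod_mul_distrib]
    _ = ∏ i, ∑ b : Bool,
          ((-1 : ℝ) ^ (b.toNat * (y i).toNat) * (-1) ^ (b.toNat * (z i).toNat)) :=
        (Fintype.prod_sum fun i (b : Bool) =>
          ((-1 : ℝ) ^ (b.toNat * (y i).toNat) * (-1) ^ (b.toNat * (z i).toNat))).symm
    _ = ∏ i, if y i = z i then (2 : ℝ) else 0 := by
        refine Finset.prod_congr rfl fun i _ => ?_
        cases y i <;> cases z i <;> norm_num
    _ = if y = z then 2 ^ n else 0 := by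
        simp [Finset.prod_ite_zero, funext_iff]

/-- The normalized character `x ↦ 2^{-n/2} (-1)^{x·y}` of the cube. -/
noncomputable def walshVector (y : Cube n) : EuclideanSpace ℝ (Cube n) :=
  WithLp.toLp 2 fun x => 1 / √((2 : ℝ) ^ n) * (-1) ^ dot x y

lemma inner_walshVector (y : Cube n) (v : EuclideanSpace ℝ (Cube n)) :
    ⟪walshVector y, v⟫ = fourierTransform v y := by
  simp only [fourierTransform, PiLp.inner_apply, Finset.mul_sum, RCLike.inner_apply, conj_trivial]
  exact Finset.sum_congr rfl fun x _ => by simp only [walshVector]; ring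

lemma abs_walshVector_apply (x y : Cube n) : |walshVector y x| = 1 / √(2 ^ n) := by
  simp [walshVector, abs_mul, abs_pow]

lemma orthonormal_walshVector : Orthonormal ℝ (walshVector (n := n)) := by
  rw [orthonormal_iff_ite]
  intro y z
  have hsq : 1 / √((2 : ℝ) ^ n) * (1 / √(2 ^ n)) * 2 ^ n = 1 := by
    field_simp
    rw [Real.sq_sqrt (by positivity)]
  calc ⟪walshVector y, walshVector z⟫
      = 1 / √(2 ^ n) * (1 / √(2 ^ n)) * ∑ x : Cube n, ((-1 : ℝ) ^ dot x y * (-1) ^ dot x z) := by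
        rw [inner_walshVector, fourierTransform, mul_assoc]
        simp only [walshVector, Finset.mul_sum, mul_left_comm]
    _ = if y = z then 1 else 0 := by
        rw [sum_neg_one_pow_dot_mul, mul_ite, mul_zero, hsq]

/-- The orthonormal basis of the characters of the cube; its coordinate map is the Fourier
transform over `ℤ₂^n`. -/
noncomputable def walshBasis (n : ℕ) : OrthonormalBasis (Cube n) ℝ (EuclideanSpace ℝ (Cube n)) :=
  (basisOfOrthonormalOfCardEqFinrank orthonormal_walshVector (by simp)).toOrthonormalBasis
    (by simpa using orthonormal_walshVector)

@[simp]
lemma coe_walshBasis : ⇑(walshBasis n) = walshVector := by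
  simp [walshBasis]

lemma walshBasis_repr_apply (v : EuclideanSpace ℝ (Cube n)) (y : Cube n) :
    (walshBasis n).repr v y = fourierTransform v y := by
  rw [OrthonormalBasis.repr_apply_apply, coe_walshBasis, inner_walshVector]

lemma phi_eq_inner (f g : EuclideanSpace ℝ (Cube n)) :
    phi f g = 1 / 2 ^ n * ⟪(walshBasis n).repr f, g⟫ := by
  have h : (2 : ℝ) ^ (3 * (n : ℝ) / 2) = 2 ^ n * √(2 ^ n) := by
    rw [Real.sqrt_eq_rpow, ← Real.rpow_natCast, ← Real.rpow_mul (by norm_num),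
      ← Real.rpow_add (by norm_num)]
    ring_nf
  rw [phi, h, Finset.sum_comm, PiLp.inner_apply]
  simp only [walshBasis_repr_apply, fourierTransform, Finset.mul_sum, RCLike.inner_apply,
    conj_trivial]
  refine Finset.sum_congr rfl fun y _ => Finset.sum_congr rfl fun x _ => ?_
  rw [← one_div_mul_one_div]
  ring

/-- The vectors whose inner products with `v` are the entries of `v` followed by those of its
Fourier transform: the standard basis and the Walsh basis. -/
noncomputable def forrelationRow : Index n → EuclideanSpace ℝ (Cube n) :=
  Sum.elim (EuclideanSpace.basisFun (Cube n) ℝ) (walshBasis n)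

lemma forrelatedString_apply (v : EuclideanSpace ℝ (Cube n)) (i : Index n) :
    forrelatedString v i = sgnBit ⟪forrelationRow i, v⟫ := by
  rcases i with x | y
  · simp only [forrelatedString, forrelationRow, Sum.elim_inl, EuclideanSpace.basisFun_inner]
  · simp only [forrelatedString, forrelationRow, Sum.elim_inr, coe_walshBasis, inner_walshVector]

lemma norm_forrelationRow (i : Index n) : ‖forrelationRow i‖ = 1 := by
  rcases i with x | y
  · exact (EuclideanSpace.basisFun (Cube n) ℝ).norm_eq_one x
  · exact (walshBasis n).norm_eq_one y

lemma abs_inner_forrelationRow_le {i j : Index n} (hij : i ≠ j) :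
    |⟪forrelationRow i, forrelationRow j⟫| ≤ 1 / √(2 ^ n) := by
  rcases i with x | y <;> rcases j with x' | y'
  · have h := (EuclideanSpace.basisFun (Cube n) ℝ).inner_eq_zero fun h => hij (congrArg Sum.inl h)
    simp only [forrelationRow, Sum.elim_inl, h, abs_zero]
    positivity
  · simp only [forrelationRow, Sum.elim_inl, Sum.elim_inr, coe_walshBasis,
      EuclideanSpace.basisFun_inner, abs_walshVector_apply, le_refl]
  · simp only [forrelationRow, Sum.elim_inl, Sum.elim_inr, coe_walshBasis,
      EuclideanSpace.inner_basisFun_real, abs_walshVector_apply, le_refl]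
  · have h := (walshBasis n).inner_eq_zero fun h => hij (congrArg Sum.inr h)
    simp only [forrelationRow, Sum.elim_inr, h, abs_zero]
    positivity

end WalshBasis

section AlmostKWiseIndependent

variable {ι : Type*}

instance isProbabilityMeasure_uniform [Finite ι] : IsProbabilityMeasure (uniform ι) :=
  isProbabilityMeasure_uniformOn Set.finite_univ Set.univ_nonempty

lemma uniform_eq_pi [Fintype ι] :
    uniform ι = Measure.pi fun _ : ι => uniformOn (Set.univ : Set Bool) := by
  rw [uniform, ← Set.pi_univ Set.univ, uniformOn_pi]

lemma uniformOn_univ_real_singleton_bool (b : Bool) :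
    (uniformOn (Set.univ : Set Bool)).real {b} = 1 / 2 := by
  rw [measureReal_def, uniformOn_univ]
  simp

lemma uniform_real_event [Finite ι] {k : ℕ} (C : KTerm ι k) :
    (uniform ι).real C.event = (1 / 2) ^ k := by
  classical
  have := Fintype.ofFinite ι
  have hevent : C.event = Set.univ.pi fun i => if i ∈ C.vars then {C.val i} else Set.univ := by
    ext z
    refine forall_congr' fun i => ?_
    by_cases hi : i ∈ C.vars <;> simp [hi]
  rw [uniform_eq_pi, hevent, measureReal_def, Measure.pi_pi, ENNReal.toReal_prod]
  simp only [← measureReal_def, apply_ite (Measure.real _),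
    uniformOn_univ_real_singleton_bool, probReal_univ]
  simp [C.card_vars]

lemma almostKWiseIndependent_iff [Finite ι] {D : Measure (ι → Bool)} {ε : ℝ} {k : ℕ} :
    AlmostKWiseIndependent D ε k ↔ ∀ C : KTerm ι k, |2 ^ k * D.real C.event - 1| ≤ ε := by
  refine forall_congr' fun C => ?_
  rw [uniform_real_event, abs_le, one_div, inv_pow, div_inv_eq_mul, mul_comm]
  constructor <;> rintro ⟨h₁, h₂⟩ <;> constructor <;> linarith

lemma AlmostKWiseIndependent.mono {D : Measure (ι → Bool)} {ε ε' : ℝ} {k : ℕ}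
    (h : AlmostKWiseIndependent D ε k) (hε : ε ≤ ε') : AlmostKWiseIndependent D ε' k :=
  fun C => ⟨by linarith [(h C).1], by linarith [(h C).2]⟩

lemma almostKWiseIndependent_uniform [Finite ι] (k : ℕ) :
    AlmostKWiseIndependent (uniform ι) 0 k :=
  almostKWiseIndependent_iff.2 fun C => by
    rw [uniform_real_event, ← mul_pow]
    norm_num

lemma abs_mul_inv_mul_sub_one_le {T p q g η β : ℝ} (hT : 1 ≤ T) (hη : η ≤ 1) (hβ : β ≤ 1 / 2)
    (hp : |T * p - 1| ≤ η) (hq : 0 ≤ q) (hqp : q ≤ p) (hpq : p ≤ q + β) (hg : 1 - β ≤ g)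
    (hg1 : g ≤ 1) : |T * (g⁻¹ * q) - 1| ≤ η + 4 * (T * β) := by
  have hg0 : 0 < g := by linarith
  have hβ0 : 0 ≤ β := by linarith
  have hη0 : 0 ≤ η := (abs_nonneg _).trans hp
  have hTβ : β ≤ T * β := le_mul_of_one_le_left hβ0 hT
  obtain ⟨hp₁, hp₂⟩ := abs_le.1 hp
  have hlower : 1 - η - T * β ≤ T * q := by nlinarith
  have hupper : T * q ≤ 1 + η := by nlinarith
  have hTq : 0 ≤ T * q := by positivity
  rw [mul_left_comm, inv_mul_eq_div, abs_le]
  constructor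
  · have : T * q ≤ T * q / g := le_div_self hTq hg0 hg1
    linarith
  · have : T * q / g ≤ 1 + η + 4 * (T * β) := by
      rw [div_le_iff₀ hg0]
      calc T * q ≤ 1 + η := hupper
        _ ≤ (1 + η + 4 * (T * β)) * (1 - β) := by nlinarith
        _ ≤ (1 + η + 4 * (T * β)) * g := by gcongr
    linarith

theorem AlmostKWiseIndependent.cond [Finite ι] {D : Measure (ι → Bool)} [IsProbabilityMeasure D]
    {η β : ℝ} {k : ℕ} (hD : AlmostKWiseIndependent D η k) {G : Set (ι → Bool)}
    (hη : η ≤ 1) (hG : D.real Gᶜ ≤ β) (hβ : β ≤ 1 / 2) :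
    AlmostKWiseIndependent D[|G] (η + 4 * (2 ^ k * β)) k := by
  have hG_meas : MeasurableSet G := (Set.toFinite G).measurableSet
  have hcompl : D.real Gᶜ = 1 - D.real G := probReal_compl_eq_one_sub hG_meas
  rw [almostKWiseIndependent_iff] at hD ⊢
  intro C
  have hsplit : D.real C.event ≤ D.real (G ∩ C.event) + D.real Gᶜ :=
    (measureReal_mono fun z hz => (em (z ∈ G)).imp (⟨·, hz⟩) id).trans (measureReal_union_le _ _)
  have hcond : D[|G].real C.event = (D.real G)⁻¹ * D.real (G ∩ C.event) := by
    simp only [measureReal_def, cond_apply hG_meas, ENNReal.toReal_mul, ENNReal.toReal_inv]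
  rw [hcond]
  exact abs_mul_inv_mul_sub_one_le (one_le_pow₀ one_le_two) hη hβ (hD C) measureReal_nonneg
    (measureReal_mono Set.inter_subset_right) (by linarith) (by linarith) measureReal_le_one

lemma isProbabilityMeasure_cond_of_compl_lt_one {Ω : Type*} [MeasurableSpace Ω] {D : Measure Ω}
    [IsProbabilityMeasure D] {G : Set Ω} (hG_meas : MeasurableSet G) (hG : D.real Gᶜ < 1) :
    IsProbabilityMeasure D[|G] :=
  cond_isProbabilityMeasure fun h => hG.ne <| by
    rw [probReal_compl_eq_one_sub hG_meas, measureReal_def, h, ENNReal.toReal_zero, sub_zero]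

end AlmostKWiseIndependent

section Forrelated

lemma forrelated_real_eq_stdGaussian_real (n : ℕ) (s : Set (Index n → Bool)) :
    (forrelated n).real s =
      (stdGaussian (EuclideanSpace ℝ (Cube n))).real {v | forrelatedString v ∈ s} := by
  have hmeas := measurable_forrelatedString n
  have hs : MeasurableSet s := (Set.toFinite s).measurableSet
  rw [forrelated, ← map_pi_eq_stdGaussian, map_measureReal_apply hmeas hs,
    map_measureReal_apply (by fun_prop) (by measurability)]
  rfl

instance isProbabilityMeasure_forrelated (n : ℕ) : IsProbabilityMeasure (forrelated n) :=
  Measure.isProbabilityMeasure_map (measurable_forrelatedString n).aemeasurable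

theorem almostKWiseIndependent_forrelated {n k : ℕ} (hk : (k : ℝ) ^ 2 * (1 / √(2 ^ n)) ≤ 1 / 2) :
    AlmostKWiseIndependent (forrelated n) (2 * ((k : ℝ) ^ 2 * (1 / √(2 ^ n)))) k := by
  rw [almostKWiseIndependent_iff]
  intro C
  have hcard : Fintype.card C.vars = k := by simp [C.card_vars]
  have h := abs_two_pow_mul_stdGaussian_sgnBit_inner_sub_one_le
    (r := fun i : C.vars => forrelationRow i.1) (fun i => norm_forrelationRow i.1)
    (δ := 1 / √(2 ^ n)) (by positivity)
    (fun i j hij => abs_inner_forrelationRow_le (Subtype.coe_ne_coe.2 hij)) (by rwa [hcard])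
    fun i => C.val i
  rw [hcard] at h
  rw [forrelated_real_eq_stdGaussian_real]
  simpa [KTerm.event, forrelatedString_apply] using h

end Forrelated

section Cramer

variable {Ω : Type*} [MeasurableSpace Ω] {μ : Measure Ω} {X : Ω → ℝ}

lemma exists_cgf_lt_mul [IsProbabilityMeasure μ] (hX : 0 ∈ interior (integrableExpSet X μ)) {a : ℝ}
    (ha : μ[X] < a) : ∃ t, 0 < t ∧ t ∈ integrableExpSet X μ ∧ cgf X μ t < a * t := by
  have hderiv : HasDerivAt (cgf X μ) μ[X] 0 := by
    have h := (analyticAt_cgf hX).differentiableAt.hasDerivAt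
    rwa [deriv_cgf_zero hX, probReal_univ, div_one] at h
  have hslope : ∀ᶠ t in 𝓝[>] 0, slope (cgf X μ) 0 t < a :=
    (hasDerivAt_iff_tendsto_slope.1 hderiv).eventually_lt_const ha |>.filter_mono
      (nhdsWithin_mono _ fun t (ht : 0 < t) => ht.ne')
  have hmem : ∀ᶠ t in 𝓝[>] 0, t ∈ integrableExpSet X μ :=
    nhdsWithin_le_nhds (mem_interior_iff_mem_nhds.1 hX)
  obtain ⟨t, hta, ht, ht0⟩ := (hslope.and (hmem.and self_mem_nhdsWithin)).exists
  refine ⟨t, ht0, ht, ?_⟩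
  rwa [slope_def_field, cgf_zero, sub_zero, sub_zero, div_lt_iff₀ ht0] at hta

lemma mgf_pi_sum [SigmaFinite μ] {ι : Type*} [Fintype ι] (t : ℝ) :
    mgf (fun ω : ι → Ω => ∑ i, X (ω i)) (Measure.pi fun _ => μ) t =
      mgf X μ t ^ Fintype.card ι := by
  simp only [mgf, Finset.mul_sum, Real.exp_sum]
  exact integral_fintype_prod_eq_pow (f := fun ω => Real.exp (t * X ω))

theorem exists_measureReal_pi_mul_card_le_sum_le [IsProbabilityMeasure μ]
    (hX : 0 ∈ interior (integrableExpSet X μ)) {a : ℝ} (ha : μ[X] < a) :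
    ∃ c > 0, ∀ (ι : Type*) [Fintype ι],
      (Measure.pi fun _ : ι => μ).real {ω | a * Fintype.card ι ≤ ∑ i, X (ω i)} ≤
        Real.exp (-c * Fintype.card ι) := by
  obtain ⟨t, ht0, ht, hcgf⟩ := exists_cgf_lt_mul hX ha
  refine ⟨a * t - cgf X μ t, sub_pos.2 hcgf, fun ι _ => ?_⟩
  have h_exp : Integrable (fun ω : ι → Ω => Real.exp (t * ∑ i, X (ω i)))
      (Measure.pi fun _ => μ) := by
    simp only [Finset.mul_sum, Real.exp_sum]
    exact .fintype_prod fun _ => ht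
  calc (Measure.pi fun _ : ι => μ).real {ω | a * Fintype.card ι ≤ ∑ i, X (ω i)}
      ≤ Real.exp (-t * (a * Fintype.card ι)) *
          mgf (fun ω : ι → Ω => ∑ i, X (ω i)) (Measure.pi fun _ => μ) t :=
        measure_ge_le_exp_mul_mgf _ ht0.le h_exp
    _ = Real.exp (-(a * t - cgf X μ t) * Fintype.card ι) := by
        rw [mgf_pi_sum, ← exp_cgf ht, ← Real.exp_nat_mul, ← Real.exp_add]
        ring_nf

end Cramer

section SignError

lemma integral_abs_gaussianReal : ∫ x, |x| ∂(gaussianReal 0 1) = √(2 / Real.pi) := by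
  have hpdf (x : ℝ) : gaussianPDFReal 0 1 x • |x| =
      (√(2 * Real.pi))⁻¹ * (|x| ^ (1 : ℝ) * Real.exp (-(1 / 2) * |x| ^ (2 : ℝ))) := by
    rw [gaussianPDFReal, Real.rpow_one, Real.rpow_two, sq_abs, sub_zero, NNReal.coe_one, mul_one,
      mul_one, smul_eq_mul]
    ring_nf
  simp only [integral_gaussianReal_eq_integral_smul one_ne_zero, hpdf]
  rw [integral_const_mul,
    integral_comp_abs (f := fun x => x ^ (1 : ℝ) * Real.exp (-(1 / 2) * x ^ (2 : ℝ))),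
    integral_rpow_mul_exp_neg_mul_rpow (by norm_num) (by norm_num) (by norm_num)]
  have hGamma : (1 / 2 : ℝ) ^ (-(1 + 1) / 2 : ℝ) * (1 / 2) * Real.Gamma ((1 + 1) / 2) = 1 := by
    norm_num
  rw [hGamma, Real.sqrt_mul zero_le_two, Real.sqrt_div zero_le_two, mul_inv]
  field_simp
  rw [Real.sq_sqrt zero_le_two]

lemma integral_sq_gaussianReal : ∫ x, x ^ 2 ∂(gaussianReal 0 1) = 1 := by
  have h := variance_fun_id_gaussianReal (μ := 0) (v := 1)
  rw [variance_eq_integral (by fun_prop)] at h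
  simpa using h

/-- The squared distance from `sgn x` to `√(2 / π) x`. The factor `√(2 / π) = 𝔼 |x|` minimizes the
mean of this distance under the standard Gaussian. -/
noncomputable def signError (x : ℝ) : ℝ := (spin (sgnBit x) - √(2 / Real.pi) * x) ^ 2

lemma signError_eq (x : ℝ) :
    signError x = 1 - 2 * √(2 / Real.pi) * |x| + 2 / Real.pi * x ^ 2 := by
  have h : spin (sgnBit x) ^ 2 = 1 ∧ spin (sgnBit x) * x = |x| := by
    rw [spin_sgnBit]
    split_ifs with hx
    · simp [abs_of_nonneg hx]
    · simp [abs_of_neg (not_le.1 hx)]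
  rw [signError, sub_sq, h.1, mul_pow, Real.sq_sqrt (by positivity), ← h.2]
  ring

@[fun_prop]
lemma measurable_signError : Measurable signError := by
  simp only [funext signError_eq]
  fun_prop

lemma integral_signError : ∫ x, signError x ∂(gaussianReal 0 1) = 1 - 2 / Real.pi := by
  have habs : Integrable (fun x : ℝ => |x|) (gaussianReal 0 1) :=
    (IsGaussian.integrable_fun_id (μ := gaussianReal 0 1)).abs
  have hsq : Integrable (fun x : ℝ => x ^ 2) (gaussianReal 0 1) :=
    (IsGaussian.memLp_two_fun_id (μ := gaussianReal 0 1)).integrable_sq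
  simp only [signError_eq]
  rw [integral_add (by fun_prop) (by fun_prop), integral_sub (by fun_prop) (by fun_prop),
    integral_const_mul, integral_const_mul, integral_abs_gaussianReal, integral_sq_gaussianReal,
    mul_assoc, Real.mul_self_sqrt (by positivity), integral_const, probReal_univ,
    smul_eq_mul]
  ring

lemma signError_nonneg (x : ℝ) : 0 ≤ signError x := sq_nonneg _

lemma signError_le (x : ℝ) : signError x ≤ 1 + x ^ 2 := by
  have hpi : 2 / Real.pi ≤ 1 := (div_le_one Real.pi_pos).2 Real.two_le_pi
  rw [signError_eq]
  have : 0 ≤ 2 * √(2 / Real.pi) * |x| := by positivity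
  nlinarith [sq_nonneg x]

lemma zero_mem_interior_integrableExpSet_signError :
    0 ∈ interior (integrableExpSet signError (gaussianReal 0 1)) := by
  obtain ⟨C, hC, h_exp⟩ := IsGaussian.exists_integrable_exp_sq (gaussianReal 0 1)
  refine mem_interior_iff_mem_nhds.2 (Filter.mem_of_superset (Iio_mem_nhds hC) fun t ht => ?_)
  refine (h_exp.const_mul (Real.exp C)).mono' ?_ (ae_of_all _ fun x => ?_)
  · fun_prop
  · rw [Real.norm_of_nonneg (Real.exp_pos _).le, ← Real.exp_add, Real.norm_eq_abs, sq_abs]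
    gcongr
    calc t * signError x ≤ C * signError x := by
          gcongr
          exacts [signError_nonneg x, le_of_lt ht]
      _ ≤ C * (1 + x ^ 2) := by gcongr; exact signError_le x
      _ = C + C * x ^ 2 := by ring

end SignError

section ForrelatedPhi

lemma norm_sq_add_norm_sq_div_two_sub_le_inner {E F : Type*} [NormedAddCommGroup E]
    [InnerProductSpace ℝ E] [NormedAddCommGroup F] [InnerProductSpace ℝ F] (H : E →ₗᵢ[ℝ] F)
    (f u : E) (g : F) :
    (‖f‖ ^ 2 + ‖g‖ ^ 2) / 2 - (‖f - u‖ ^ 2 + ‖g - H u‖ ^ 2) ≤ ⟪H f, g⟫ := by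
  have htriangle : ‖H f - g‖ ≤ ‖f - u‖ + ‖g - H u‖ := by
    rw [← H.norm_map (f - u), H.map_sub, norm_sub_rev g]
    exact norm_sub_le_norm_sub_add_norm_sub ..
  have hexpand := norm_sub_sq_real (H f) g
  rw [H.norm_map] at hexpand
  nlinarith [norm_nonneg (H f - g), sq_nonneg (‖f - u‖ - ‖g - H u‖)]

lemma spin_sq (b : Bool) : spin b ^ 2 = 1 := by
  cases b <;> norm_num [spin]

lemma norm_sq_toLp_spin {ι : Type*} [Fintype ι] (b : ι → Bool) :
    ‖WithLp.toLp 2 fun i => spin (b i)‖ ^ 2 = Fintype.card ι := by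
  simp [EuclideanSpace.real_norm_sq_eq, spin_sq]

lemma norm_sq_toLp_spin_sgnBit_sub_smul {ι : Type*} [Fintype ι] (v : EuclideanSpace ℝ ι) :
    ‖(WithLp.toLp 2 fun i => spin (sgnBit (v i))) - √(2 / Real.pi) • v‖ ^ 2 =
      ∑ i, signError (v i) := by
  simp [EuclideanSpace.real_norm_sq_eq, signError]

lemma one_sub_sum_signError_le_phiString {n : ℕ} (v : EuclideanSpace ℝ (Cube n)) :
    1 - 1 / 2 ^ n * (∑ x, signError (v x) + ∑ y, signError ((walshBasis n).repr v y)) ≤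
      phiString (forrelatedString v) := by
  set H := (walshBasis n).repr
  set f : EuclideanSpace ℝ (Cube n) := WithLp.toLp 2 fun x => spin (sgnBit (v x))
  set g : EuclideanSpace ℝ (Cube n) := WithLp.toLp 2 fun y => spin (sgnBit (H v y))
  have hphi : phiString (forrelatedString v) = 1 / 2 ^ n * ⟪H f, g⟫ := by
    rw [← phi_eq_inner]
    simp [phiString, forrelatedString, f, g, H, walshBasis_repr_apply]
  have hcard : (Fintype.card (Cube n) : ℝ) = 2 ^ n := by simp
  have h := norm_sq_add_norm_sq_div_two_sub_le_inner H.toLinearIsometry f (√(2 / Real.pi) • v) g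
  rw [norm_sq_toLp_spin, norm_sq_toLp_spin, norm_sq_toLp_spin_sgnBit_sub_smul, map_smul,
    LinearIsometryEquiv.coe_toLinearIsometry, norm_sq_toLp_spin_sgnBit_sub_smul, hcard] at h
  calc 1 - 1 / 2 ^ n * (∑ x, signError (v x) + ∑ y, signError (H v y))
      = 1 / 2 ^ n * ((2 ^ n + 2 ^ n) / 2 -
          (∑ x, signError (v x) + ∑ y, signError (H v y))) := by field_simp; ring
    _ ≤ phiString (forrelatedString v) := by rw [hphi]; gcongr

lemma exists_stdGaussian_mul_card_le_sum_signError_le {a : ℝ} (ha : 1 - 2 / Real.pi < a) :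
    ∃ c > 0, ∀ (ι : Type*) [Fintype ι],
      (stdGaussian (EuclideanSpace ℝ ι)).real {v | a * Fintype.card ι ≤ ∑ i, signError (v i)} ≤
        Real.exp (-c * Fintype.card ι) := by
  obtain ⟨c, hc, h⟩ := exists_measureReal_pi_mul_card_le_sum_le
    zero_mem_interior_integrableExpSet_signError (integral_signError.trans_lt ha)
  refine ⟨c, hc, fun ι _ => ?_⟩
  rw [← map_pi_eq_stdGaussian, map_measureReal_apply (by fun_prop)
    (measurableSet_le measurable_const (by fun_prop))]
  exact h ι

theorem exists_forrelated_real_compl_le {θ : ℝ} (hθ : θ < 4 / Real.pi - 1) :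
    ∃ c > 0, ∀ n, (forrelated n).real {z | θ ≤ phiString z}ᶜ ≤ 2 * Real.exp (-c * 2 ^ n) := by
  obtain ⟨c, hc, htail⟩ := exists_stdGaussian_mul_card_le_sum_signError_le (a := (1 - θ) / 2)
    (by ring_nf at hθ ⊢; linarith)
  refine ⟨c, hc, fun n => ?_⟩
  set H := (walshBasis n).repr
  set B : Set (EuclideanSpace ℝ (Cube n)) := {v | (1 - θ) / 2 * 2 ^ n ≤ ∑ x, signError (v x)}
  have hB : (stdGaussian (EuclideanSpace ℝ (Cube n))).real B ≤ Real.exp (-c * 2 ^ n) := by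
    simpa using htail (Cube n)
  have hHB : (stdGaussian (EuclideanSpace ℝ (Cube n))).real (H ⁻¹' B) ≤ Real.exp (-c * 2 ^ n) := by
    rwa [← map_measureReal_apply (by fun_prop) (measurableSet_le measurable_const (by fun_prop)),
      stdGaussian_map]
  have hsubset : {v : EuclideanSpace ℝ (Cube n) | forrelatedString v ∈ {z | θ ≤ phiString z}ᶜ} ⊆
      B ∪ H ⁻¹' B := by
    intro v hv
    by_contra! hvB
    obtain ⟨h₁, h₂⟩ : ∑ x, signError (v x) < (1 - θ) / 2 * 2 ^ n ∧
        ∑ y, signError (H v y) < (1 - θ) / 2 * 2 ^ n := by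
      simpa [B] using hvB
    refine hv (le_trans ?_ (one_sub_sum_signError_le_phiString v))
    have : 1 / 2 ^ n * (∑ x, signError (v x) + ∑ y, signError (H v y)) ≤ 1 - θ := by
      rw [one_div_mul_eq_div, div_le_iff₀ (by positivity)]
      linarith
    linarith
  rw [forrelated_real_eq_stdGaussian_real, two_mul]
  exact (measureReal_mono hsubset).trans ((measureReal_union_le _ _).trans (add_le_add hB hHB))

end ForrelatedPhi

section UniformPhi

lemma integral_uniform_sum {ι κ : Type*} [Finite ι] [Finite κ] (F : (ι ⊕ κ → Bool) → ℝ) :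
    ∫ z, F z ∂uniform (ι ⊕ κ) = ∫ a, ∫ b, F (Sum.elim a b) ∂uniform κ ∂uniform ι := by
  have := Fintype.ofFinite ι
  have := Fintype.ofFinite κ
  have h := measurePreserving_sumPiEquivProdPi_symm
    fun _ : ι ⊕ κ => uniformOn (Set.univ : Set Bool)
  simp only [← uniform_eq_pi] at h
  rw [← h.integral_comp', integral_prod _ .of_finite]
  exact integral_congr_ae (ae_of_all _ fun a => integral_congr_ae (ae_of_all _ fun b => rfl))

lemma hasSubgaussianMGF_spin : HasSubgaussianMGF spin 1 (uniformOn (Set.univ : Set Bool)) := by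
  have hmean : ∫ b, spin b ∂uniformOn (Set.univ : Set Bool) = 0 := by
    rw [integral_fintype .of_finite]
    simp only [Fintype.sum_bool, uniformOn_univ_real_singleton_bool, spin]
    norm_num
  have h := hasSubgaussianMGF_of_mem_Icc_of_integral_eq_zero (a := -1) (b := 1)
    (Measurable.of_discrete.aemeasurable) (ae_of_all _ fun b => by cases b <;> simp [spin]) hmean
  convert h
  ext
  norm_num

lemma hasSubgaussianMGF_sum_mul_spin {ι : Type*} [Fintype ι] (c : ι → ℝ) :
    HasSubgaussianMGF (fun z : ι → Bool => ∑ i, c i * spin (z i)) (∑ i, ‖c i‖₊ ^ 2)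
      (uniform ι) := by
  rw [uniform_eq_pi]
  refine .sum_of_iIndepFun (iIndepFun_pi (X := fun i b => c i * spin b) fun i =>
    Measurable.of_discrete.aemeasurable) fun i _ => ?_
  have h : HasSubgaussianMGF (fun b => c i * spin b) (‖c i‖₊ ^ 2)
      ((Measure.pi fun _ : ι => uniformOn (Set.univ : Set Bool)).map fun z => z i) := by
    rw [(measurePreserving_eval _ i).map_eq]
    convert hasSubgaussianMGF_spin.const_mul (c i)
    ext
    exact (sq_abs (c i)).trans (mul_one _).symm
  exact h.of_map (X := fun b => c i * spin b) (measurable_pi_apply i).aemeasurable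

variable {n : ℕ}

lemma phiString_sumElim (a b : Cube n → Bool) :
    phiString (Sum.elim a b) =
      ∑ y, 1 / 2 ^ n * (walshBasis n).repr (WithLp.toLp 2 fun x => spin (a x)) y * spin (b y) := by
  have h := phi_eq_inner (n := n) (WithLp.toLp 2 fun x => spin (a x))
    (WithLp.toLp 2 fun y => spin (b y))
  rw [PiLp.inner_apply, Finset.mul_sum] at h
  refine h.trans (Finset.sum_congr rfl fun y _ => ?_)
  simp only [RCLike.inner_apply, conj_trivial]
  ring

lemma hasSubgaussianMGF_phiString :
    HasSubgaussianMGF phiString (2 ^ n)⁻¹ (uniform (Index n)) where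
  integrable_exp_mul t := .of_finite
  mgf_le t := by
    have hvar (a : Cube n → Bool) : ∑ y, ‖1 / 2 ^ n *
        (walshBasis n).repr (WithLp.toLp 2 fun x => spin (a x)) y‖₊ ^ 2 = (2 ^ n)⁻¹ := by
      ext
      have h := norm_sq_toLp_spin a
      rw [← (walshBasis n).repr.norm_map, EuclideanSpace.real_norm_sq_eq] at h
      rw [Fintype.card_pi_const, Fintype.card_bool, Nat.cast_pow, Nat.cast_two] at h
      push_cast
      simp only [norm_mul, mul_pow, Real.norm_eq_abs, sq_abs, ← Finset.mul_sum, h]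
      field_simp
    have hcond (a : Cube n → Bool) :
        ∫ b, Real.exp (t * phiString (Sum.elim a b)) ∂uniform (Cube n) ≤
          Real.exp ((2 ^ n : NNReal)⁻¹ * t ^ 2 / 2) := by
      simp only [phiString_sumElim, ← hvar a]
      exact (hasSubgaussianMGF_sum_mul_spin _).mgf_le t
    rw [mgf, integral_uniform_sum]
    calc ∫ a, ∫ b, Real.exp (t * phiString (Sum.elim a b)) ∂uniform (Cube n) ∂uniform (Cube n)
        ≤ ∫ _ : Cube n → Bool, Real.exp ((2 ^ n : NNReal)⁻¹ * t ^ 2 / 2) ∂uniform (Cube n) :=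
          integral_mono .of_finite .of_finite hcond
      _ = Real.exp ((2 ^ n : NNReal)⁻¹ * t ^ 2 / 2) := by simp

lemma measureReal_lt_abs_le_of_hasSubgaussianMGF {Ω : Type*} [MeasurableSpace Ω] {μ : Measure Ω}
    [IsFiniteMeasure μ] {X : Ω → ℝ} {c : NNReal} (hX : HasSubgaussianMGF X c μ) {a : ℝ}
    (ha : 0 ≤ a) : μ.real {ω | a < |X ω|} ≤ 2 * Real.exp (-a ^ 2 / (2 * c)) := by
  have hsubset : {ω | a < |X ω|} ⊆ {ω | a ≤ X ω} ∪ {ω | a ≤ (-X) ω} :=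
    fun ω hω => (lt_abs.1 hω).imp (fun h => h.le) fun (h : a < -X ω) => h.le
  rw [two_mul]
  exact (measureReal_mono hsubset).trans <| (measureReal_union_le _ _).trans <|
    add_le_add (hX.measure_ge_le ha) (hX.neg.measure_ge_le ha)

theorem uniform_real_compl_abs_phiString_le {a : ℝ} (ha : 0 ≤ a) (n : ℕ) :
    (uniform (Index n)).real {z | |phiString z| ≤ a}ᶜ ≤ 2 * Real.exp (-(a ^ 2 / 2) * 2 ^ n) := by
  have h := measureReal_lt_abs_le_of_hasSubgaussianMGF (hasSubgaussianMGF_phiString (n := n)) ha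
  simp only [Set.compl_ofPred, not_le]
  convert h using 3
  push_cast
  field_simp

end UniformPhi

section Asymptotics

lemma isLittleO_rpow_rpow_atTop {p q : ℝ} (hpq : p < q) :
    (fun x : ℝ => x ^ p) =o[Filter.atTop] fun x => x ^ q := by
  refine (isLittleO_iff_tendsto' ?_).2
    ((tendsto_rpow_neg_atTop (sub_pos.2 hpq)).congr' ?_)
  · filter_upwards [Filter.eventually_gt_atTop 0] with x hx h
    exact absurd h (Real.rpow_pos_of_pos hx q).ne'
  · filter_upwards [Filter.eventually_gt_atTop 0] with x hx
    rw [neg_sub, Real.rpow_sub hx]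

variable {α : Type*} {l : Filter α}

lemma isLittleO_rpow_of_abs_le_rpow {f N δ : α → ℝ} (hN : Filter.Tendsto N l Filter.atTop)
    (hδ : Filter.Tendsto δ l (𝓝 0)) (hf : ∀ᶠ a in l, |f a| ≤ N a ^ δ a) {p : ℝ} (hp : 0 < p) :
    f =o[l] fun a => N a ^ p := by
  refine IsBigO.trans_isLittleO (g := fun a => N a ^ (p / 2)) (.of_bound' ?_)
    ((isLittleO_rpow_rpow_atTop (half_lt_self hp)).comp_tendsto hN)
  filter_upwards [hf, hN.eventually_ge_atTop 1, hδ.eventually_le_const (half_pos hp)]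
    with a hfa hNa hδa
  exact (hfa.trans (Real.rpow_le_rpow_of_exponent_le hNa hδa)).trans (le_abs_self _)

lemma tendsto_two_pow_mul_exp_neg_mul {k : α → ℕ} {N : α → ℝ}
    (hN : Filter.Tendsto N l Filter.atTop) (hk : (fun a => (k a : ℝ)) =o[l] N) {c : ℝ}
    (hc : 0 < c) :
    Filter.Tendsto (fun a => (2 : ℝ) ^ k a * Real.exp (-c * N a)) l (𝓝 0) := by
  refine squeeze_zero' (.of_forall fun a => by positivity) ?_ <|
    Real.tendsto_exp_neg_atTop_nhds_zero.comp (hN.const_mul_atTop (half_pos hc))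
  filter_upwards [hk.bound (half_pos hc), hN.eventually_ge_atTop 0] with a hka hNa
  rw [Real.norm_natCast, Real.norm_of_nonneg hNa] at hka
  have htwo : (2 : ℝ) ^ k a ≤ Real.exp (k a) := by
    rw [← Real.exp_one_pow]
    gcongr
    linarith [Real.add_one_le_exp (1 : ℝ)]
  calc (2 : ℝ) ^ k a * Real.exp (-c * N a) ≤ Real.exp (k a) * Real.exp (-c * N a) := by gcongr
    _ = Real.exp (k a - c * N a) := by rw [← Real.exp_add]; ring_nf
    _ ≤ Real.exp (-(c / 2 * N a)) := by gcongr; linarith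

lemma tendsto_sq_mul_one_div_sqrt {k N : α → ℝ} (hN : ∀ a, 0 ≤ N a)
    (hk : k =o[l] fun a => N a ^ (1 / 4 : ℝ)) :
    Filter.Tendsto (fun a => k a ^ 2 * (1 / √(N a))) l (𝓝 0) := by
  refine (hk.pow two_pos).tendsto_div_nhds_zero.congr fun a => ?_
  rw [div_eq_mul_one_div, ← Real.rpow_mul_natCast (hN a), Real.sqrt_eq_rpow]
  norm_num

end Asymptotics

section Conditioning

lemma isProbabilityMeasure_and_almostKWiseIndependent_cond {ι : Type*} [Finite ι]
    {D : Measure (ι → Bool)} [IsProbabilityMeasure D] {η β ε : ℝ} {k : ℕ}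
    (hD : AlmostKWiseIndependent D η k) {G : Set (ι → Bool)} (hη : η ≤ 1) (hG : D.real Gᶜ ≤ β)
    (hβ : β ≤ 1 / 2) (hε : η + 4 * (2 ^ k * β) ≤ ε) :
    IsProbabilityMeasure D[|G] ∧ AlmostKWiseIndependent D[|G] ε k :=
  ⟨isProbabilityMeasure_cond_of_compl_lt_one (Set.toFinite G).measurableSet (by linarith),
    (hD.cond hη hG hβ).mono hε⟩

lemma exists_forrelated_and_uniform_real_compl_le :
    ∃ c > 0, ∀ n, (forrelated n).real {z | 0.07 ≤ phiString z}ᶜ ≤ 2 * Real.exp (-c * 2 ^ n) ∧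
      (uniform (Index n)).real {z | |phiString z| ≤ 0.01}ᶜ ≤ 2 * Real.exp (-c * 2 ^ n) := by
  have hpi : (0.07 : ℝ) < 4 / Real.pi - 1 := by
    rw [lt_sub_iff_add_lt, lt_div_iff₀ Real.pi_pos]
    linarith [Real.pi_lt_d2]
  obtain ⟨c, hc, hF⟩ := exists_forrelated_real_compl_le hpi
  refine ⟨min c (0.01 ^ 2 / 2), by positivity, fun n => ⟨(hF n).trans ?_,
    (uniform_real_compl_abs_phiString_le (by norm_num) n).trans ?_⟩⟩
  · gcongr
    exact min_le_left ..
  · gcongr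
    exact min_le_right ..

end Conditioning

end Forrelation

open Asymptotics in
theorem mainTheorem10_general (k : ℕ → ℕ)
    (hk : (fun n => (k n : ℝ)) =o[Filter.atTop] fun n => ((2 : ℝ) ^ n) ^ (1 / 4 : ℝ)) :
    ∃ ε : ℕ → ℝ, Filter.Tendsto ε Filter.atTop (𝓝 0) ∧
      ∀ᶠ n in Filter.atTop,
        (MeasureTheory.IsProbabilityMeasure (Forrelation.forrelatedCond n) ∧
          Forrelation.AlmostKWiseIndependent (Forrelation.forrelatedCond n) (ε n) (k n)) ∧
        (MeasureTheory.IsProbabilityMeasure (Forrelation.uniformCond n) ∧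
          Forrelation.AlmostKWiseIndependent (Forrelation.uniformCond n) (ε n) (k n)) := by
  obtain ⟨c, hc, htail⟩ := Forrelation.exists_forrelated_and_uniform_real_compl_le
  have hN : Filter.Tendsto (fun n : ℕ => (2 : ℝ) ^ n) Filter.atTop Filter.atTop :=
    tendsto_pow_atTop_atTop_of_one_lt one_lt_two
  have hkN : (fun n => (k n : ℝ)) =o[Filter.atTop] fun n => (2 : ℝ) ^ n := by
    have hquarter := Forrelation.isLittleO_rpow_rpow_atTop (p := 1 / 4) (q := 1) (by norm_num)
    simpa [Function.comp_def] using hk.trans (hquarter.comp_tendsto hN)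
  have hη := Forrelation.tendsto_sq_mul_one_div_sqrt (fun n => by positivity) hk
  have hβ := (Forrelation.tendsto_two_pow_mul_exp_neg_mul hN hkN hc).const_mul 2
  rw [mul_zero] at hβ
  refine ⟨fun n => 2 * ((k n : ℝ) ^ 2 * (1 / √(2 ^ n))) +
    4 * (2 * (2 ^ k n * Real.exp (-c * 2 ^ n))), ?_, ?_⟩
  · simpa only [mul_zero, add_zero] using (hη.const_mul 2).add (hβ.const_mul 4)
  filter_upwards [hη.eventually_le_const one_half_pos, hβ.eventually_le_const one_half_pos]
    with n hηn hβn
  have hβ_le : 2 * Real.exp (-c * 2 ^ n) ≤ 1 / 2 := hβn.trans' <| by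
    gcongr
    exact le_mul_of_one_le_left (Real.exp_pos _).le (one_le_pow₀ one_le_two)
  exact ⟨Forrelation.isProbabilityMeasure_and_almostKWiseIndependent_cond
      (Forrelation.almostKWiseIndependent_forrelated hηn) (by linarith) (htail n).1 hβ_le
      (by rw [mul_left_comm (2 ^ k n)]),
    Forrelation.isProbabilityMeasure_and_almostKWiseIndependent_cond
      (Forrelation.almostKWiseIndependent_uniform (k n)) zero_le_one (htail n).2 hβ_le
      (by rw [mul_left_comm (2 ^ k n)]; gcongr; positivity)⟩

theorem mainTheorem10 (k : ℕ → ℕ)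
    (hk : ∃ δ : ℕ → ℝ, Filter.Tendsto δ Filter.atTop (𝓝 0) ∧
      ∀ᶠ n in Filter.atTop, (k n : ℝ) ≤ ((2 : ℝ) ^ n) ^ δ n) :
    ∃ ε : ℕ → ℝ, Filter.Tendsto ε Filter.atTop (𝓝 0) ∧
      ∀ᶠ n in Filter.atTop,
        (MeasureTheory.IsProbabilityMeasure (Forrelation.forrelatedCond n) ∧
          Forrelation.AlmostKWiseIndependent (Forrelation.forrelatedCond n) (ε n) (k n)) ∧
        (MeasureTheory.IsProbabilityMeasure (Forrelation.uniformCond n) ∧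
          Forrelation.AlmostKWiseIndependent (Forrelation.uniformCond n) (ε n) (k n)) := by
  obtain ⟨δ, hδ, hkδ⟩ := hk
  exact mainTheorem10_general k <| Forrelation.isLittleO_rpow_of_abs_le_rpow
    (tendsto_pow_atTop_atTop_of_one_lt one_lt_two) hδ (by simpa using hkδ) (by norm_num)
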